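/- Fix an integer $d\ge 2$ and a real number $\delta<\frac{d-1}{d+1}$. Let $\mathcal H$ be the random $d$-uniform hypergraph on the vertex set $[n]$ in which each $d$-subset of $[n]$ is a hyperedge independently with probability $p=n^{-d+1+\delta}$. For a $d$-uniform hypergraph $H$, let $\mathrm{Proj}(H)$ be the graph on the same vertex set in which two distinct vertices are adjacent if and only if some hyperedge contains both; then $H$ is called a preimage of $\mathrm{Proj}(H)$, and a minimum preimage of a graph is a preimage (on the same vertex set) with the fewest hyperedges. A finite graph is ambiguous if it has at least two minimum preimages. For a graph $G$, let $\mathrm{Cli}(G)$ be the $d$-uniform hypergraph whose hyperedges are the $d$-element cliques of $G$. A 2-connected component of a hypergraph is the set of hyperedges of a connected component of the graph whose nodes are the hyperedges, two distinct hyperedges being adjacent when they share at least two vertices. Put $G_p=\mathrm{Proj}(\mathcal H)$ and $\mathcal H_c=\mathrm{Cli}(G_p)$. Suppose that for every finite ambiguous graph $G_a$ (fixed, not depending on $n$), $$\Pr\bigl(\text{a copy of }\mathrm{Cli}(G_a)\text{ is a 2-connected component of }\mathcal H_c\bigr)\to 0\quad(n\to\infty),$$ where a copy is the image under an injection of the vertex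 set of $G_a$ into $[n]$. Then the maximum a posteriori (MAP) rule $\mathcal A^*$ satisfies $$\Pr\bigl(\mathcal A^*(G_p)=\mathcal H\bigr)\to 1\quad(n\to\infty).$$ This holds with ties broken in an arbitrary deterministic way, both when $\mathcal A^*(G)$ is any hypergraph maximizing the posterior probability $\Pr(\mathcal H=H\mid G_p=G)$ and when $\mathcal A^*(G)$ is any minimum preimage of $G$ (for all large $n$ the two descriptions coincide on graphs that have a preimage). -/

import Mathlib

/-! A hypergraph on a finite vertex set `V` is given by its set of hyperedges, a
`Finset (Finset V)`; it is `d`-uniform if all hyperedges have `d` elements. -/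

namespace HypergraphProjection

/-- All `d`-uniform hypergraphs on the vertex set `V`. -/
def uniformHypergraphs (V : Type*) [Fintype V] (d : ℕ) : Finset (Finset (Finset V)) :=
  (Finset.powersetCard d (Finset.univ : Finset V)).powerset

/-- The projected graph of a hypergraph: two distinct vertices are adjacent when some hyperedge
contains both of them. -/
def proj {V : Type*} (H : Finset (Finset V)) : SimpleGraph V where
  Adj i j := i ≠ j ∧ ∃ h ∈ H, i ∈ h ∧ j ∈ h
  symm := ⟨fun _ _ hij => ⟨hij.1.symm, hij.2.imp fun _ h => ⟨h.1, h.2.2, h.2.1⟩⟩⟩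
  loopless := ⟨fun _ hi => hi.1 rfl⟩

open Classical in
/-- The clique hypergraph of a graph: its hyperedges are the `d`-element cliques. -/
noncomputable def cli {V : Type*} [Fintype V] (d : ℕ) (G : SimpleGraph V) :
    Finset (Finset V) :=
  G.cliqueFinset d

/-- The 2-neighbour graph on the hyperedges of `H`: distinct hyperedges are adjacent when they
share at least two vertices. -/
def twoNeighborGraph {V : Type*} [DecidableEq V] (H : Finset (Finset V)) :
    SimpleGraph {h : Finset V // h ∈ H} where
  Adj h h' := h ≠ h' ∧ 2 ≤ (h.1 ∩ h'.1).card
  symm := ⟨fun h h' hh => ⟨hh.1.symm, by rw [Finset.inter_comm]; exact hh.2⟩⟩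
  loopless := ⟨fun _ hi => hi.1 rfl⟩

/-- `C` is a 2-connected component of `H`: the set of hyperedges of a connected component of the
2-neighbour graph of `H`. -/
def IsTwoConnectedComponent {V : Type*} [DecidableEq V] (H C : Finset (Finset V)) : Prop :=
  ∃ c : (twoNeighborGraph H).ConnectedComponent,
    (C : Set (Finset V)) = Subtype.val '' c.supp

/-- `H` is a `d`-uniform hypergraph with projection `G`. -/
def IsPreimage {V : Type*} [Fintype V] (d : ℕ) (G : SimpleGraph V)
    (H : Finset (Finset V)) : Prop :=
  H ∈ uniformHypergraphs V d ∧ proj H = G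

/-- `H` is a preimage of `G` with the smallest possible number of hyperedges. -/
def IsMinPreimage {V : Type*} [Fintype V] (d : ℕ) (G : SimpleGraph V)
    (H : Finset (Finset V)) : Prop :=
  IsPreimage d G H ∧ ∀ H', IsPreimage d G H' → H.card ≤ H'.card

/-- A graph is ambiguous if it has at least two minimum preimages. -/
def IsAmbiguous {V : Type*} [Fintype V] (d : ℕ) (G : SimpleGraph V) : Prop :=
  ∃ H₁ H₂, H₁ ≠ H₂ ∧ IsMinPreimage d G H₁ ∧ IsMinPreimage d G H₂

/-- The probability of the event `A` for the random `d`-uniform hypergraph on `n` labelled vertices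
in which each `d`-subset is a hyperedge with probability `p`, independently of the others. -/
noncomputable def prob (n d : ℕ) (p : ℝ) (A : Set (Finset (Finset (Fin n)))) : ℝ :=
  ∑ H ∈ uniformHypergraphs (Fin n) d,
    A.indicator (fun H => p ^ H.card * (1 - p) ^ (n.choose d - H.card)) H

/-- The posterior probability that the random hypergraph equals `H`, given that its projection
is `G`. -/
noncomputable def posterior (n d : ℕ) (p : ℝ) (G : SimpleGraph (Fin n))
    (H : Finset (Finset (Fin n))) : ℝ :=
  prob n d p {H' | H' = H ∧ proj H' = G} / prob n d p {H' | proj H' = G}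

/-- `A` is a maximum a posteriori rule: its output maximises the posterior probability.
(For a graph `G` that is the projection with probability `0` this is no constraint.) -/
def IsMAPRule (n d : ℕ) (p : ℝ) (A : SimpleGraph (Fin n) → Finset (Finset (Fin n))) : Prop :=
  ∀ G H, posterior n d p G H ≤ posterior n d p G (A G)

/-- `A` outputs a minimum preimage of every graph that has a preimage. -/
def IsMinPreimageRule (n d : ℕ) (A : SimpleGraph (Fin n) → Finset (Finset (Fin n))) : Prop :=
  ∀ G, (∃ H, IsPreimage d G H) → IsMinPreimage d G (A G)

/-- The event that (a copy of) the clique hypergraph of the graph `Ga` is a 2-connected component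
of the clique hypergraph of the projected graph of `H`. -/
def AppearsAsComponent {k n : ℕ} (d : ℕ) (Ga : SimpleGraph (Fin k))
    (H : Finset (Finset (Fin n))) : Prop :=
  ∃ f : Fin k ↪ Fin n,
    IsTwoConnectedComponent (cli d (proj H)) ((cli d Ga).image (Finset.map f))

/-- The hyperedge probability `n ^ (-d + 1 + δ)`. -/
noncomputable def edgeProb (d : ℕ) (δ : ℝ) (n : ℕ) : ℝ :=
  (n : ℝ) ^ (-(d : ℝ) + 1 + δ)

end HypergraphProjection

/-! Write T for the clique hypergraph of the projection G of the random hypergraph H. Every pair of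
vertices covered by a hyperedge is covered within one 2-connected component of T, so preimages of G
can be cut and swapped component by component (`IsPreimage.inter`, `IsPreimage.sdiff_union`). For p
< 1/2 the posterior strictly decreases with the number of hyperedges, so a MAP rule returns a
minimum preimage M. If M ≠ H, they differ on some component C, and one of three things happens
(`failure_cases`).

1. C has many vertices. Exploring C from a hyperedge lowers the exponent |V(F)| - |F|(d - 1 - δ) of
the expected number of copies of the explored F by a fixed amount per step; this is where δ <
(d-1)/(d+1) enters. Boundedly many steps reach exponent -1, and a union bound applies
(`exists_explored`, `prob_dense_le`).

2. C is small but H ∩ C is not minimum. Swapping in M ∩ C gives a smaller hypergraph; charging H to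
it costs probability O(n^d p^2), which tends to 0 for d ≥ 3 (`prob_isLocalEnlargement_le`). For d =
2 preimages are unique.

3. C is small and both H ∩ C and M ∩ C are minimum. Then C is a copy of the clique hypergraph of an
ambiguous graph of bounded size. There are finitely many such graphs, and the hypothesis handles
each. -/

namespace HypergraphProjection

open Finset Filter Topology

/-! ### Preimages and 2-connected components -/

section Deterministic

variable {V : Type*} {d : ℕ} {G : SimpleGraph V} {H : Finset (Finset V)}

lemma mem_uniformHypergraphs [Fintype V] : H ∈ uniformHypergraphs V d ↔ ∀ h ∈ H, h.card = d := by
  simp [uniformHypergraphs, Finset.subset_iff, Finset.mem_powersetCard]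

lemma mem_cli [Fintype V] {x : Finset V} : x ∈ cli d G ↔ G.IsNClique d x := by
  classical
  simp [cli, SimpleGraph.mem_cliqueFinset_iff]

lemma proj_mono {H H' : Finset (Finset V)} (h : H ⊆ H') : proj H ≤ proj H' := by
  rintro i j ⟨hij, x, hx, hi, hj⟩
  exact ⟨hij, x, h hx, hi, hj⟩

lemma proj_le_of_subset_cli [Fintype V] (h : H ⊆ cli d G) : proj H ≤ G := by
  rintro i j ⟨hij, x, hx, hi, hj⟩
  exact (mem_cli.1 (h hx)).1 hi hj hij

lemma mem_cli_proj [Fintype V] {x : Finset V} (hx : x ∈ H) (hd : x.card = d) : x ∈ cli d (proj H) := by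
  refine mem_cli.2 ⟨fun i hi j hj hij => ⟨hij, x, hx, hi, hj⟩, hd⟩

lemma IsPreimage.subset_cli [Fintype V] (h : IsPreimage d G H) : H ⊆ cli d G := by
  intro x hx
  rw [← h.2]
  exact mem_cli_proj hx (mem_uniformHypergraphs.1 h.1 x hx)

lemma two_le_card_inter [DecidableEq V] {x y : Finset V} :
    2 ≤ (x ∩ y).card ↔ ∃ i j, i ≠ j ∧ i ∈ x ∧ j ∈ x ∧ i ∈ y ∧ j ∈ y := by
  rw [show 2 ≤ (x ∩ y).card ↔ 1 < (x ∩ y).card from Iff.rfl, Finset.one_lt_card]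
  constructor
  · rintro ⟨i, hi, j, hj, hij⟩
    rw [Finset.mem_inter] at hi hj
    exact ⟨i, j, hij, hi.1, hj.1, hi.2, hj.2⟩
  · rintro ⟨i, j, hij, h1, h2, h3, h4⟩
    exact ⟨i, Finset.mem_inter.2 ⟨h1, h3⟩, j, Finset.mem_inter.2 ⟨h2, h4⟩, hij⟩

/-- Every `d`-clique of `proj H` shares two vertices with a hyperedge of `H`. -/
lemma exists_mem_two_le_card_inter [Fintype V] [DecidableEq V] (hd : 2 ≤ d) {x : Finset V}
    (hx : x ∈ cli d (proj H)) : ∃ h ∈ H, 2 ≤ (x ∩ h).card := by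
  obtain ⟨hc, hcard⟩ := mem_cli.1 hx
  obtain ⟨i, hi, j, hj, hij⟩ := Finset.one_lt_card.1 (show 1 < x.card by omega)
  obtain ⟨-, h, hh, hih, hjh⟩ := hc hi hj hij
  exact ⟨h, hh, two_le_card_inter.2 ⟨i, j, hij, hi, hj, hih, hjh⟩⟩

/-- The set `C` of hyperedges of `T` is a union of 2-connected components of `T`. -/
def IsTwoClosed [DecidableEq V] (T C : Finset (Finset V)) : Prop :=
  C ⊆ T ∧ ∀ x ∈ C, ∀ y ∈ T, 2 ≤ (x ∩ y).card → y ∈ C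

open Classical in
/-- The 2-connected component of the hyperedge `h` in the hypergraph `T`. -/
noncomputable def componentOf [DecidableEq V] (T : Finset (Finset V)) (h : Finset V) :
    Finset (Finset V) :=
  T.filter fun x => ∃ (hh : h ∈ T) (hx : x ∈ T), (twoNeighborGraph T).Reachable ⟨h, hh⟩ ⟨x, hx⟩

variable [DecidableEq V] {T C : Finset (Finset V)} {h : Finset V}

lemma mem_componentOf_self (hh : h ∈ T) : h ∈ componentOf T h := by
  simp only [componentOf, Finset.mem_filter]
  exact ⟨hh, hh, hh, SimpleGraph.Reachable.refl _⟩

lemma isTwoClosed_componentOf : IsTwoClosed T (componentOf T h) := by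
  classical
  refine ⟨Finset.filter_subset _ _, fun x hx y hy hxy => ?_⟩
  simp only [componentOf, Finset.mem_filter] at hx ⊢
  obtain ⟨hxT, hh, hx', hr⟩ := hx
  refine ⟨hy, hh, hy, ?_⟩
  by_cases hne : x = y
  · subst hne; exact hr
  · refine hr.trans (SimpleGraph.Adj.reachable ?_)
    exact ⟨fun he => hne (congrArg Subtype.val he), hxy⟩

lemma isTwoConnectedComponent_componentOf (hh : h ∈ T) :
    IsTwoConnectedComponent T (componentOf T h) := by
  refine ⟨(twoNeighborGraph T).connectedComponentMk ⟨h, hh⟩, ?_⟩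
  ext x
  simp only [componentOf, Finset.coe_filter, Set.mem_ofPred_eq, Set.mem_image,
    SimpleGraph.ConnectedComponent.mem_supp_iff, SimpleGraph.ConnectedComponent.eq,
    Subtype.exists, exists_and_right, exists_eq_right]
  constructor
  · rintro ⟨hx, hh, _, hr⟩
    exact ⟨hx, hr.symm⟩
  · rintro ⟨hx, hr⟩
    exact ⟨hx, hh, hx, hr.symm⟩

/-- A component with a hyperedge in a 2-closed set is contained in that set. -/
lemma componentOf_subset_of_isTwoClosed (hC : IsTwoClosed T C) (hh : h ∈ C) :
    componentOf T h ⊆ C := by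
  intro x hx
  simp only [componentOf, Finset.mem_filter] at hx
  obtain ⟨-, hhT, hxT, ⟨w⟩⟩ := hx
  have key : ∀ a b : {h : Finset V // h ∈ T}, (twoNeighborGraph T).Walk a b → a.1 ∈ C → b.1 ∈ C := by
    intro a b w
    induction w with
    | nil => exact id
    | cons hadj _ ih => exact fun ha => ih (hC.2 _ ha _ (Subtype.property _) hadj.2)
  exact key _ _ w hh

lemma componentOf_eq_of_two_le_card_inter {x y : Finset V} (hx : x ∈ T) (hy : y ∈ T)
    (hxy : 2 ≤ (x ∩ y).card) : componentOf T x = componentOf T y := by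
  refine (componentOf_subset_of_isTwoClosed isTwoClosed_componentOf ?_).antisymm
    (componentOf_subset_of_isTwoClosed isTwoClosed_componentOf ?_)
  · exact isTwoClosed_componentOf.2 y (mem_componentOf_self hy) x hx (by rwa [Finset.inter_comm])
  · exact isTwoClosed_componentOf.2 x (mem_componentOf_self hx) y hy hxy

/-- A clique of `proj C` shares a pair with a member of `C`, so closedness absorbs it. Thus a
component is itself the clique hypergraph of a graph, the form in which ambiguity is assumed rare.
-/
lemma cli_proj_eq_of_isTwoClosed [Fintype V] (hd : 2 ≤ d) (hC : IsTwoClosed (cli d G) C) :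
    cli d (proj C) = C := by
  ext x
  constructor
  · intro hx
    obtain ⟨h, hh, hxh⟩ := exists_mem_two_le_card_inter hd hx
    refine hC.2 h hh x ?_ (by rwa [Finset.inter_comm])
    have := mem_cli.1 hx
    exact mem_cli.2 (this.mono (proj_le_of_subset_cli hC.1))
  · intro hx
    exact mem_cli_proj hx (mem_cli.1 (hC.1 hx)).2

/-- A hyperedge of `H` covering a pair inside a member of `C` shares that pair with it, hence lies
in `C`. -/
lemma IsPreimage.inter [Fintype V] (hH : IsPreimage d G H) (hC : IsTwoClosed (cli d G) C) :
    IsPreimage d (proj C) (H ∩ C) := by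
  refine ⟨mem_uniformHypergraphs.2 fun h hh =>
    mem_uniformHypergraphs.1 hH.1 h (Finset.mem_inter.1 hh).1,
    le_antisymm (proj_mono Finset.inter_subset_right) ?_⟩
  rintro i j ⟨hij, x, hx, hi, hj⟩
  have hG : G.Adj i j := (mem_cli.1 (hC.1 hx)).1 hi hj hij
  rw [← hH.2] at hG
  obtain ⟨-, h, hh, hih, hjh⟩ := hG
  exact ⟨hij, h, Finset.mem_inter.2 ⟨hh, hC.2 x hx h (hH.subset_cli hh)
    (two_le_card_inter.2 ⟨i, j, hij, hi, hj, hih, hjh⟩)⟩, hih, hjh⟩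

/-- Replacing the part of a preimage in a 2-closed set by another preimage of that part. -/
lemma IsPreimage.sdiff_union [Fintype V] (hH : IsPreimage d G H) (hC : IsTwoClosed (cli d G) C)
    {X : Finset (Finset V)} (hX : IsPreimage d (proj C) X) : IsPreimage d G (H \ C ∪ X) := by
  refine ⟨mem_uniformHypergraphs.2 fun h hh => ?_, le_antisymm ?_ ?_⟩
  · rcases Finset.mem_union.1 hh with hh | hh
    · exact mem_uniformHypergraphs.1 hH.1 h (Finset.mem_sdiff.1 hh).1
    · exact mem_uniformHypergraphs.1 hX.1 h hh
  · rintro i j ⟨hij, x, hx, hi, hj⟩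
    rcases Finset.mem_union.1 hx with hx | hx
    · exact (mem_cli.1 (hH.subset_cli (Finset.mem_sdiff.1 hx).1)).1 hi hj hij
    · refine proj_le_of_subset_cli hC.1 ?_
      rw [← hX.2]
      exact ⟨hij, x, hx, hi, hj⟩
  · intro i j hG
    rw [← hH.2] at hG
    obtain ⟨hij, h, hh, hih, hjh⟩ := hG
    by_cases hhC : h ∈ C
    · have : (proj X).Adj i j := by
        rw [hX.2]
        exact ⟨hij, h, hhC, hih, hjh⟩
      exact proj_mono Finset.subset_union_right this
    · exact ⟨hij, h, Finset.mem_union_left _ (Finset.mem_sdiff.2 ⟨hh, hhC⟩), hih, hjh⟩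

/-- A smaller preimage of the part in `C` could be swapped in, contradicting global minimality. -/
lemma IsMinPreimage.inter [Fintype V] (hH : IsMinPreimage d G H)
    (hC : IsTwoClosed (cli d G) C) : IsMinPreimage d (proj C) (H ∩ C) := by
  refine ⟨hH.1.inter hC, fun X hX => ?_⟩
  have h1 := hH.2 _ (hH.1.sdiff_union hC hX)
  have h2 := Finset.card_union_le (H \ C) X
  have h3 := Finset.card_sdiff_add_card_inter H C
  omega

/-- By `hcov` every component of `T` contains a member of `M`, so agreement on the components of
members of `M` is agreement everywhere. -/
lemma exists_inter_componentOf_ne {M H T : Finset (Finset V)} (hM : M ⊆ T) (hH : H ⊆ T)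
    (hcov : ∀ x ∈ T, ∃ m ∈ M, 2 ≤ (x ∩ m).card) (hne : M ≠ H) :
    ∃ m ∈ M, M ∩ componentOf T m ≠ H ∩ componentOf T m := by
  by_contra! hcon
  apply hne
  ext x
  have key : x ∈ T → (x ∈ M ↔ x ∈ H) := by
    intro hx
    obtain ⟨m, hm, hxm⟩ := hcov x hx
    have hxC : x ∈ componentOf T m := isTwoClosed_componentOf.2 m (mem_componentOf_self (hM hm)) x hx
      (by rwa [Finset.inter_comm])
    have := congrArg (x ∈ ·) (hcon m hm)
    simpa [hxC] using this
  exact ⟨fun h => (key (hM h)).1 h, fun h => (key (hH h)).2 h⟩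

end Deterministic

/-! ### Relabelling vertices -/

section Map

variable {V W : Type*} [DecidableEq V] {d : ℕ}

lemma proj_image_map (f : W ↪ V) (X : Finset (Finset W)) :
    proj (X.image (Finset.map f)) = (proj X).map f := by
  ext i j
  simp only [SimpleGraph.map_adj]
  constructor
  · rintro ⟨hij, x, hx, hi, hj⟩
    obtain ⟨y, hy, rfl⟩ := Finset.mem_image.1 hx
    obtain ⟨a, ha, rfl⟩ := Finset.mem_map.1 hi
    obtain ⟨b, hb, rfl⟩ := Finset.mem_map.1 hj
    exact ⟨a, b, ⟨fun h => hij (congrArg f h), y, hy, ha, hb⟩, rfl, rfl⟩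
  · rintro ⟨a, b, ⟨hab, y, hy, ha, hb⟩, rfl, rfl⟩
    exact ⟨fun h => hab (f.injective h), y.map f, Finset.mem_image_of_mem _ hy,
      Finset.mem_map_of_mem _ ha, Finset.mem_map_of_mem _ hb⟩

lemma isPreimage_image_map [Fintype V] [Fintype W] {f : W ↪ V} {G : SimpleGraph W}
    {X : Finset (Finset W)} :
    IsPreimage d (G.map f) (X.image (Finset.map f)) ↔ IsPreimage d G X := by
  simp only [IsPreimage, mem_uniformHypergraphs, proj_image_map,
    (SimpleGraph.map_injective f).eq_iff, Finset.forall_mem_image, Finset.card_map]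

/-- Since `d ≥ 2`, each vertex of a hyperedge has a neighbour in `G.map f`, so it lies in the range
of `f`. -/
lemma IsPreimage.exists_eq_image_map [Fintype V] [Fintype W] (hd : 2 ≤ d) {f : W ↪ V}
    {G : SimpleGraph W} {Y : Finset (Finset V)} (hY : IsPreimage d (G.map f) Y) :
    ∃ X : Finset (Finset W), X.image (Finset.map f) = Y := by
  classical
  refine ⟨Finset.univ.filter fun x => x.map f ∈ Y, ?_⟩
  ext y
  simp only [Finset.mem_image, Finset.mem_filter, Finset.mem_univ, true_and]
  constructor
  · rintro ⟨x, hx, rfl⟩; exact hx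
  · intro hy
    have hyr : ∀ v ∈ y, v ∈ Set.range f := by
      intro v hv
      have hc := mem_cli.1 (hY.subset_cli hy)
      obtain ⟨w, hw, hwv⟩ := Finset.exists_mem_ne (show 1 < y.card by rw [hc.2]; omega) v
      have := hc.1 hv hw hwv.symm
      rw [SimpleGraph.map_adj] at this
      obtain ⟨a, b, -, ha, -⟩ := this
      exact ⟨a, ha⟩
    have he : (y.preimage f f.injective.injOn).map f = y := by
      ext v
      simp only [Finset.mem_map, Finset.mem_preimage]
      constructor
      · rintro ⟨a, ha, rfl⟩; exact ha
      · intro hv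
        obtain ⟨a, rfl⟩ := hyr v hv
        exact ⟨a, hv, rfl⟩
    exact ⟨_, by rwa [he], he⟩

lemma IsAmbiguous.of_map [Fintype V] [Fintype W] (hd : 2 ≤ d) {f : W ↪ V} {G : SimpleGraph W}
    (h : IsAmbiguous d (G.map f)) : IsAmbiguous d G := by
  have hinj : Function.Injective (Finset.map f) := Finset.map_injective f
  have key : ∀ X : Finset (Finset W), IsMinPreimage d (G.map f) (X.image (Finset.map f)) →
      IsMinPreimage d G X := by
    intro X hX
    refine ⟨isPreimage_image_map.1 hX.1, fun X' hX' => ?_⟩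
    have := hX.2 _ (isPreimage_image_map.2 hX')
    rwa [Finset.card_image_of_injective _ hinj, Finset.card_image_of_injective _ hinj] at this
  obtain ⟨Y₁, Y₂, hne, h₁, h₂⟩ := h
  obtain ⟨X₁, rfl⟩ := h₁.1.exists_eq_image_map hd
  obtain ⟨X₂, rfl⟩ := h₂.1.exists_eq_image_map hd
  exact ⟨X₁, X₂, fun he => hne (by rw [he]), key _ h₁, key _ h₂⟩

lemma cli_map [Fintype V] [Fintype W] (hd : 2 ≤ d) (f : W ↪ V) (G : SimpleGraph W) :
    cli d (G.map f) = (cli d G).image (Finset.map f) := by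
  classical
  ext x
  -- Size 1 is excluded because vertices outside the range of `f` are 1-cliques of the larger graph.
  have := SimpleGraph.cliqueSet_map (show d ≠ 1 by omega) G f
  have hx := congrArg (x ∈ ·) this
  simpa [mem_cli] using hx

end Map

/-- If the projection of a 2-connected component on at most `K` vertices is ambiguous, then the
component is a copy of the clique hypergraph of an ambiguous graph on `Fin k` with `k ≤ K`. -/
lemma exists_appearsAsComponent {n d : ℕ} (hd : 2 ≤ d) {H : Finset (Finset (Fin n))}
    {m : Finset (Fin n)} (hm : m ∈ cli d (proj H))
    (hamb : IsAmbiguous d (proj (componentOf (cli d (proj H)) m))) :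
    ∃ Ga : SimpleGraph (Fin ((componentOf (cli d (proj H)) m).sup id).card),
      IsAmbiguous d Ga ∧ AppearsAsComponent d Ga H := by
  set C := componentOf (cli d (proj H)) m with hC
  set U := C.sup id with hU
  let f : Fin U.card ↪ Fin n := (U.orderEmbOfFin rfl).toEmbedding
  -- All edges of `proj C` lie inside `U`, so restricting to `U` loses none.
  have hmap : ((proj C).comap f).map f = proj C := by
    apply SimpleGraph.map_comap_le f _ |>.antisymm
    rintro i j hij
    rw [SimpleGraph.map_adj]
    have hr : ∀ v ∈ U, ∃ a, f a = v := by
      intro v hv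
      have : v ∈ Set.range (U.orderEmbOfFin rfl) := by
        rw [Finset.range_orderEmbOfFin]; exact hv
      exact this
    obtain ⟨-, x, hx, hi, hj⟩ := id hij
    have hxU : x ⊆ U := Finset.le_sup (f := id) hx
    obtain ⟨a, rfl⟩ := hr i (hxU hi)
    obtain ⟨b, rfl⟩ := hr j (hxU hj)
    exact ⟨a, b, hij, rfl, rfl⟩
  refine ⟨(proj C).comap f, IsAmbiguous.of_map hd (f := f) (by rwa [hmap]), f, ?_⟩
  rw [← cli_map hd, hmap, cli_proj_eq_of_isTwoClosed hd isTwoClosed_componentOf]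
  exact isTwoConnectedComponent_componentOf hm

/-! ### Exploring a component -/

section Exploration

variable {V : Type*} [DecidableEq V] {d : ℕ}

/-- The arithmetic inequality behind the exploration: the hyperedges `N` that cover all pairs of a
`d`-set `h` not contained in `U` overlap with `h` in many vertices. -/
lemma sum_card_inter_sub_ge {δ : ℝ} (hδ : δ < ((d : ℝ) - 1) / ((d : ℝ) + 1))
    {h U : Finset V} (hh : h.card = d) (hU : 2 ≤ (h ∩ U).card) {N : Finset (Finset V)}
    (hN : N.Nonempty) (hN2 : ∀ g ∈ N, 2 ≤ (g ∩ h).card)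
    (hcov : ∀ q ∈ h.powersetCard 2, ¬ q ⊆ U → ∃ g ∈ N, q ⊆ g) :
    ((h \ U).card : ℝ) + ((d - 1) / (d + 1) - δ) ≤ ∑ g ∈ N, (((g ∩ h).card : ℝ) - 1 - δ) := by
  set ε : ℝ := (d - 1) / (d + 1) - δ with hε
  have hεpos : 0 < ε := by simp only [hε]; linarith
  have hd1 : (0 : ℝ) < (d : ℝ) + 1 := by positivity
  -- With a = |g ∩ h|, the convex function a(a-1)/(d+1) lies below its chord on [2, d], which is the
  -- line a - 1 - (d-1)/(d+1).
  have hterm : ∀ g ∈ N, ε + 2 / ((d : ℝ) + 1) * ((g ∩ h).card.choose 2 : ℕ) ≤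
      ((g ∩ h).card : ℝ) - 1 - δ := by
    intro g hg
    have ha : (2 : ℝ) ≤ ((g ∩ h).card : ℝ) := by exact_mod_cast hN2 g hg
    have hb : ((g ∩ h).card : ℝ) ≤ d := by
      have := Finset.card_le_card (Finset.inter_subset_right (s₁ := g) (s₂ := h))
      rw [hh] at this
      exact_mod_cast this
    set a : ℝ := ((g ∩ h).card : ℝ) with hadef
    rw [Nat.cast_choose_two, ← hadef]
    have h1 : ε + 2 / ((d : ℝ) + 1) * (a * (a - 1) / 2) =
        a - 1 - δ - (a - 2) * (d - a) / (d + 1) := by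
      simp only [hε]
      field_simp
      ring
    rw [h1]
    have : 0 ≤ (a - 2) * (d - a) / ((d : ℝ) + 1) :=
      div_nonneg (mul_nonneg (by linarith) (by linarith)) hd1.le
    linarith
  have hpairs : d.choose 2 ≤ (h ∩ U).card.choose 2 + ∑ g ∈ N, (g ∩ h).card.choose 2 := by
    have hsub : h.powersetCard 2 ⊆
        (h ∩ U).powersetCard 2 ∪ N.biUnion fun g => (g ∩ h).powersetCard 2 := by
      intro q hq
      obtain ⟨hqh, hq2⟩ := Finset.mem_powersetCard.1 hq
      by_cases hqU : q ⊆ U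
      · exact Finset.mem_union_left _
          (Finset.mem_powersetCard.2 ⟨Finset.subset_inter hqh hqU, hq2⟩)
      · obtain ⟨g, hg, hqg⟩ := hcov q hq hqU
        exact Finset.mem_union_right _ (Finset.mem_biUnion.2
          ⟨g, hg, Finset.mem_powersetCard.2 ⟨Finset.subset_inter hqg hqh, hq2⟩⟩)
    have h1 := Finset.card_le_card hsub
    have h2 := Finset.card_union_le ((h ∩ U).powersetCard 2)
      (N.biUnion fun g => (g ∩ h).powersetCard 2)
    have h3 := Finset.card_biUnion_le (s := N) (t := fun g => (g ∩ h).powersetCard 2)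
    simp only [Finset.card_powersetCard, hh] at h1 h2 h3
    omega
  have hsum := Finset.sum_le_sum hterm
  rw [Finset.sum_add_distrib, ← Finset.mul_sum, Finset.sum_const, nsmul_eq_mul] at hsum
  have hN1 : (1 : ℝ) ≤ N.card := by exact_mod_cast hN.card_pos
  have hs : ((h \ U).card : ℝ) + ((h ∩ U).card : ℝ) = d := by
    rw [← hh]
    exact_mod_cast Finset.card_sdiff_add_card_inter h U
  have hpairs' : ((d.choose 2 : ℕ) : ℝ) ≤
      ((h ∩ U).card.choose 2 : ℕ) + ∑ g ∈ N, ((g ∩ h).card.choose 2 : ℝ) := by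
    exact_mod_cast hpairs
  rw [Nat.cast_choose_two, Nat.cast_choose_two] at hpairs'
  have hU' : (2 : ℝ) ≤ ((h ∩ U).card : ℝ) := by exact_mod_cast hU
  set P : ℝ := ∑ g ∈ N, ((g ∩ h).card.choose 2 : ℝ)
  set s : ℝ := ((h ∩ U).card : ℝ)
  set r : ℝ := ((h \ U).card : ℝ) with hr
  have hr0 : 0 ≤ r := by positivity
  -- Pair counting gives 2P ≥ d(d-1) - s(s-1) = r(d+s-1), and s ≥ 2.
  have hmain : r ≤ 2 / ((d : ℝ) + 1) * P := by
    rw [div_mul_eq_mul_div, le_div_iff₀ hd1]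
    have : (d : ℝ) = r + s := hs.symm
    rw [this] at hpairs' ⊢
    nlinarith
  nlinarith

variable [Fintype V]

/-- One exploration step. -/
lemma exists_extension {δ : ℝ} (hδ : δ < ((d : ℝ) - 1) / ((d : ℝ) + 1))
    {H F : Finset (Finset V)} (hH : H ∈ uniformHypergraphs V d) (hF : F ⊆ H)
    {h : Finset V} (hh : h ∈ cli d (proj H)) (hU : 2 ≤ (h ∩ F.sup id).card)
    (hnot : ¬ h ⊆ F.sup id) :
    ∃ F' ⊆ H, F ⊆ F' ∧ F'.card ≤ F.card + 2 ^ d ∧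
      ((F'.sup id).card : ℝ) - F'.card * ((d : ℝ) - 1 - δ) ≤
        ((F.sup id).card : ℝ) - F.card * ((d : ℝ) - 1 - δ) - ((d - 1) / (d + 1) - δ) := by
  set U := F.sup id with hUdef
  obtain ⟨hclique, hcard⟩ := mem_cli.1 hh
  -- One hyperedge is chosen for each pair of `h` not already inside `U`; such a hyperedge cannot
  -- belong to `F`.
  set Q := (h.powersetCard 2).filter fun q => ¬ q ⊆ U with hQ
  have hex : ∀ q ∈ Q, ∃ g ∈ H, q ⊆ g := by
    intro q hq
    obtain ⟨hqh, hq2⟩ := Finset.mem_powersetCard.1 (Finset.mem_filter.1 hq).1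
    obtain ⟨i, j, hij, rfl⟩ := Finset.card_eq_two.1 hq2
    obtain ⟨-, g, hg, hi, hj⟩ := hclique (hqh (Finset.mem_insert_self _ _))
      (hqh (Finset.mem_insert_of_mem (Finset.mem_singleton_self _))) hij
    exact ⟨g, hg, by simp [Finset.insert_subset_iff, hi, hj]⟩
  choose! c hcH hcq using hex
  set N := Q.image c with hNdef
  have hNH : N ⊆ H := by
    intro g hg
    obtain ⟨q, hq, rfl⟩ := Finset.mem_image.1 hg
    exact hcH q hq
  have hdisj : Disjoint F N := by
    rw [Finset.disjoint_left]
    intro g hgF hgN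
    obtain ⟨q, hq, rfl⟩ := Finset.mem_image.1 hgN
    exact (Finset.mem_filter.1 hq).2 ((hcq q hq).trans (Finset.le_sup (f := id) hgF))
  have hN2 : ∀ g ∈ N, 2 ≤ (g ∩ h).card := by
    intro g hg
    obtain ⟨q, hq, rfl⟩ := Finset.mem_image.1 hg
    obtain ⟨hqh, hq2⟩ := Finset.mem_powersetCard.1 (Finset.mem_filter.1 hq).1
    rw [← hq2]
    exact Finset.card_le_card (Finset.subset_inter (hcq q hq) hqh)
  have hcov : ∀ q ∈ h.powersetCard 2, ¬ q ⊆ U → ∃ g ∈ N, q ⊆ g := fun q hq hqU =>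
    have hqQ : q ∈ Q := Finset.mem_filter.2 ⟨hq, hqU⟩
    ⟨c q, Finset.mem_image_of_mem _ hqQ, hcq q hqQ⟩
  have hNne : N.Nonempty := by
    obtain ⟨x, hxh, hxU⟩ := Finset.not_subset.1 hnot
    obtain ⟨y, hy⟩ : (h ∩ U).Nonempty := Finset.card_pos.1 (by omega)
    obtain ⟨hyh, hyU⟩ := Finset.mem_inter.1 hy
    have hxy : x ≠ y := fun he => hxU (he ▸ hyU)
    obtain ⟨g, hg, -⟩ := hcov {x, y} (Finset.mem_powersetCard.2
      ⟨by simp [Finset.insert_subset_iff, hxh, hyh], Finset.card_pair hxy⟩)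
      fun hs => hxU (hs (Finset.mem_insert_self _ _))
    exact ⟨g, hg⟩
  have hNcard : N.card ≤ 2 ^ d := by
    refine Finset.card_image_le.trans ((Finset.card_filter_le _ _).trans ?_)
    rw [Finset.card_powersetCard, hcard]
    exact Nat.choose_le_two_pow _ _
  have hsup : (F ∪ N).sup id ⊆ U ∪ (h \ U) ∪ N.biUnion fun g => g \ h := by
    intro v hv
    obtain ⟨g, hg, hvg⟩ := Finset.mem_sup.1 hv
    by_cases hvU : v ∈ U
    · simp [hvU]
    by_cases hvh : v ∈ h
    · simp [hvh]
    rcases Finset.mem_union.1 hg with hg | hg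
    · exact absurd (Finset.le_sup (f := id) hg hvg) hvU
    · exact Finset.mem_union_right _ (Finset.mem_biUnion.2 ⟨g, hg, Finset.mem_sdiff.2 ⟨hvg, hvh⟩⟩)
  have hcardsup : ((F ∪ N).sup id).card ≤ U.card + (h \ U).card + ∑ g ∈ N, (g \ h).card := by
    refine (Finset.card_le_card hsup).trans ((Finset.card_union_le _ _).trans ?_)
    exact add_le_add (Finset.card_union_le _ _) Finset.card_biUnion_le
  refine ⟨F ∪ N, Finset.union_subset hF hNH, Finset.subset_union_left, ?_, ?_⟩
  · exact (Finset.card_union_le _ _).trans (by omega)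
  · have hmain := sum_card_inter_sub_ge hδ hcard hU hNne hN2 hcov
    have hc : (((F ∪ N).sup id).card : ℝ) ≤
        U.card + (h \ U).card + ∑ g ∈ N, ((g \ h).card : ℝ) := by exact_mod_cast hcardsup
    have hsd : ∀ g ∈ N, ((g \ h).card : ℝ) = d - (g ∩ h).card := by
      intro g hg
      have h1 := Finset.card_sdiff_add_card_inter g h
      rw [mem_uniformHypergraphs.1 hH g (hNH hg)] at h1
      rw [← h1]
      push_cast
      ring
    rw [Finset.sum_congr rfl hsd] at hc
    rw [Finset.card_union_of_disjoint hdisj]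
    simp only [Finset.sum_sub_distrib, Finset.sum_const, nsmul_eq_mul] at hc hmain
    push_cast
    linarith

/-- Exploring the cliques around a hyperedge for `t` steps either stops, or finds a dense set of
hyperedges. -/
lemma exists_explored {δ : ℝ} (hδ : δ < ((d : ℝ) - 1) / ((d : ℝ) + 1))
    {H : Finset (Finset V)} (hH : H ∈ uniformHypergraphs V d) {h₀ : Finset V} (h₀H : h₀ ∈ H)
    (t : ℕ) :
    ∃ F ⊆ H, h₀ ∈ F ∧ F.card ≤ 1 + t * 2 ^ d ∧
      ((∀ h ∈ cli d (proj H), 2 ≤ (h ∩ F.sup id).card → h ⊆ F.sup id) ∨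
        ((F.sup id).card : ℝ) - F.card * ((d : ℝ) - 1 - δ) ≤
          1 + δ - t * ((d - 1) / (d + 1) - δ)) := by
  induction t with
  | zero =>
    refine ⟨{h₀}, by simpa using h₀H, by simp, by simp, Or.inr ?_⟩
    simp [mem_uniformHypergraphs.1 hH h₀ h₀H]
  | succ t ih =>
    obtain ⟨F, hFH, h₀F, hcard, hF⟩ := ih
    have hle : 1 + t * 2 ^ d ≤ 1 + (t + 1) * 2 ^ d := by gcongr; omega
    by_cases hcl : ∀ h ∈ cli d (proj H), 2 ≤ (h ∩ F.sup id).card → h ⊆ F.sup id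
    · exact ⟨F, hFH, h₀F, hcard.trans hle, Or.inl hcl⟩
    · have hw := hF.resolve_left hcl
      push Not at hcl
      obtain ⟨h, hh, hU, hnot⟩ := hcl
      obtain ⟨F', hF'H, hFF', hcard', hw'⟩ := exists_extension hδ hH hFH hh hU hnot
      refine ⟨F', hF'H, hFF' h₀F, ?_, Or.inr ?_⟩
      · rw [add_mul, one_mul]; omega
      · push_cast; linarith

/-- If `H` contains no small dense set of hyperedges, then the 2-connected components of the clique
hypergraph of its projection have few vertices. -/
lemma card_sup_componentOf_le {δ : ℝ} (hδ : δ < ((d : ℝ) - 1) / ((d : ℝ) + 1))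
    {H : Finset (Finset V)} (hH : H ∈ uniformHypergraphs V d) {t : ℕ}
    (hdense : ∀ F ⊆ H, F.card ≤ 1 + t * 2 ^ d →
      1 + δ - t * ((d - 1) / (d + 1) - δ) < ((F.sup id).card : ℝ) - F.card * ((d : ℝ) - 1 - δ))
    {h₀ : Finset V} (h₀H : h₀ ∈ H) :
    ((componentOf (cli d (proj H)) h₀).sup id).card ≤ (1 + t * 2 ^ d) * d := by
  obtain ⟨F, hFH, h₀F, hcard, hF⟩ := exists_explored hδ hH h₀H t
  have hF := hF.resolve_right (not_le.2 (hdense F hFH hcard))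
  -- When exploration stops, the cliques inside the explored vertex set form a 2-closed family,
  -- which traps the component.
  have hclosed : IsTwoClosed (cli d (proj H)) ((cli d (proj H)).filter (· ⊆ F.sup id)) := by
    refine ⟨Finset.filter_subset _ _, fun x hx y hy hxy => Finset.mem_filter.2 ⟨hy, hF y hy ?_⟩⟩
    refine hxy.trans (Finset.card_le_card ?_)
    rw [Finset.inter_comm]
    exact Finset.inter_subset_inter_left (Finset.mem_filter.1 hx).2
  have hsub := componentOf_subset_of_isTwoClosed hclosed (h := h₀) (Finset.mem_filter.2
    ⟨mem_cli_proj h₀H (mem_uniformHypergraphs.1 hH h₀ h₀H), Finset.le_sup (f := id) h₀F⟩)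
  have hsup : (componentOf (cli d (proj H)) h₀).sup id ⊆ F.sup id :=
    Finset.sup_le fun x hx => (Finset.mem_filter.1 (hsub hx)).2
  refine (Finset.card_le_card hsup).trans ?_
  rw [Finset.sup_eq_biUnion]
  refine (Finset.card_biUnion_le_card_mul _ _ d fun x hx => ?_).trans
    (Nat.mul_le_mul_right _ hcard)
  exact (mem_uniformHypergraphs.1 hH x (hFH hx)).le

end Exploration

/-! ### Weights, union bounds and first moments -/

section Probability

variable {n d : ℕ} {p : ℝ}

lemma weight_nonneg (hp0 : 0 ≤ p) (hp1 : p ≤ 1) (H : Finset (Finset (Fin n))) :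
    0 ≤ p ^ H.card * (1 - p) ^ (n.choose d - H.card) :=
  mul_nonneg (pow_nonneg hp0 _) (pow_nonneg (sub_nonneg.2 hp1) _)

lemma prob_eq_sum_filter (A : Set (Finset (Finset (Fin n)))) [DecidablePred (· ∈ A)] :
    prob n d p A = ∑ H ∈ (uniformHypergraphs (Fin n) d).filter (· ∈ A),
      p ^ H.card * (1 - p) ^ (n.choose d - H.card) := by
  rw [prob, Finset.sum_filter]
  exact Finset.sum_congr rfl fun H _ => by simp [Set.indicator_apply]

lemma prob_nonneg (hp0 : 0 ≤ p) (hp1 : p ≤ 1) (A : Set (Finset (Finset (Fin n)))) :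
    0 ≤ prob n d p A :=
  Finset.sum_nonneg fun H _ => Set.indicator_nonneg (fun H _ => weight_nonneg hp0 hp1 H) H

lemma card_edges : (Finset.powersetCard d (Finset.univ : Finset (Fin n))).card = n.choose d := by
  rw [Finset.card_powersetCard, Finset.card_univ, Fintype.card_fin]

lemma card_le_choose {H : Finset (Finset (Fin n))} (hH : H ∈ uniformHypergraphs (Fin n) d) :
    H.card ≤ n.choose d := by
  rw [← card_edges]
  exact Finset.card_le_card (Finset.mem_powerset.1 hH)

/-- The probability that all elements of `F` are hyperedges. -/
lemma prob_superset {F : Finset (Finset (Fin n))} (hF : F ∈ uniformHypergraphs (Fin n) d) :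
    prob n d p {H | F ⊆ H} = p ^ F.card := by
  classical
  set S := Finset.powersetCard d (Finset.univ : Finset (Fin n)) with hS
  have hFS : F ⊆ S := Finset.mem_powerset.1 hF
  have hcard : (S \ F).card + F.card = n.choose d := by
    rw [Finset.card_sdiff_add_card_eq_card hFS, card_edges]
  have h1 : prob n d p {H | F ⊆ H} =
      ∑ X ∈ (S \ F).powerset, p ^ F.card * (p ^ X.card * (1 - p) ^ ((S \ F).card - X.card)) := by
    rw [prob_eq_sum_filter]
    refine Finset.sum_nbij' (fun H => H \ F) (fun X => X ∪ F) ?_ ?_ ?_ ?_ ?_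
    · intro H hH
      obtain ⟨hH, -⟩ := Finset.mem_filter.1 hH
      exact Finset.mem_powerset.2 (Finset.sdiff_subset_sdiff (Finset.mem_powerset.1 hH) subset_rfl)
    · intro X hX
      refine Finset.mem_filter.2 ⟨Finset.mem_powerset.2 (Finset.union_subset
        ((Finset.mem_powerset.1 hX).trans Finset.sdiff_subset) hFS), Finset.subset_union_right⟩
    · intro H hH
      exact Finset.sdiff_union_of_subset (Finset.mem_filter.1 hH).2
    · intro X hX
      rw [Finset.union_sdiff_right]
      exact Finset.sdiff_eq_self_of_disjoint
        (Finset.disjoint_of_subset_left (Finset.mem_powerset.1 hX) Finset.sdiff_disjoint)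
    · intro H hH
      obtain ⟨-, hFH⟩ := Finset.mem_filter.1 hH
      have h2 : (H \ F).card + F.card = H.card := Finset.card_sdiff_add_card_eq_card hFH
      rw [← mul_assoc, ← pow_add, add_comm F.card, h2]
      congr 2
      omega
  rw [h1, ← Finset.mul_sum, Finset.sum_pow_mul_eq_add_pow]
  simp

lemma prob_eq_one_of_forall {A : Set (Finset (Finset (Fin n)))}
    (hA : ∀ H ∈ uniformHypergraphs (Fin n) d, H ∈ A) : prob n d p A = 1 := by
  have h := prob_superset (n := n) (d := d) (p := p) (F := ∅)
    (mem_uniformHypergraphs.2 (by simp))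
  rw [Finset.card_empty, pow_zero] at h
  rw [← h]
  exact Finset.sum_congr rfl fun H hH => by
    rw [Set.indicator_of_mem (hA H hH), Set.indicator_of_mem (Finset.empty_subset H)]

lemma prob_compl (A : Set (Finset (Finset (Fin n)))) :
    prob n d p A = 1 - prob n d p Aᶜ := by
  rw [eq_sub_iff_add_eq, ← prob_eq_one_of_forall (n := n) (d := d) (p := p) (A := Set.univ)
    (fun _ _ => Set.mem_univ _), prob, prob, prob, ← Finset.sum_add_distrib]
  refine Finset.sum_congr rfl fun H _ => ?_
  rw [Set.indicator_univ, ← Pi.add_apply, Set.indicator_self_add_compl]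

lemma prob_le_sum {ι : Type*} (hp0 : 0 ≤ p) (hp1 : p ≤ 1) {A : Set (Finset (Finset (Fin n)))}
    (s : Finset ι) (B : ι → Set (Finset (Finset (Fin n))))
    (hAB : ∀ H ∈ uniformHypergraphs (Fin n) d, H ∈ A → ∃ i ∈ s, H ∈ B i) :
    prob n d p A ≤ ∑ i ∈ s, prob n d p (B i) := by
  simp only [prob]
  rw [Finset.sum_comm]
  refine Finset.sum_le_sum fun H hH => ?_
  have h0 : ∀ i ∈ s, 0 ≤ (B i).indicator
      (fun H => p ^ H.card * (1 - p) ^ (n.choose d - H.card)) H :=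
    fun i _ => Set.indicator_nonneg (fun H _ => weight_nonneg hp0 hp1 H) H
  by_cases hA : H ∈ A
  · obtain ⟨i, hi, hHi⟩ := hAB H hH hA
    refine le_trans ?_ (Finset.single_le_sum h0 hi)
    rw [Set.indicator_of_mem hA, Set.indicator_of_mem hHi]
  · rw [Set.indicator_of_notMem hA]
    exact Finset.sum_nonneg h0

lemma prob_le_add_add (hp0 : 0 ≤ p) (hp1 : p ≤ 1) {A B₁ B₂ B₃ : Set (Finset (Finset (Fin n)))}
    (hAB : ∀ H ∈ uniformHypergraphs (Fin n) d, H ∈ A → H ∈ B₁ ∨ H ∈ B₂ ∨ H ∈ B₃) :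
    prob n d p A ≤ prob n d p B₁ + prob n d p B₂ + prob n d p B₃ := by
  have := prob_le_sum hp0 hp1 (A := A) (d := d) Finset.univ ![B₁, B₂, B₃] fun H hH hA => by
    rcases hAB H hH hA with h | h | h
    · exact ⟨0, Finset.mem_univ _, h⟩
    · exact ⟨1, Finset.mem_univ _, h⟩
    · exact ⟨2, Finset.mem_univ _, h⟩
  simpa [Fin.sum_univ_three] using this

/-- The expected number of hyperedges. -/
lemma sum_weight_mul_card :
    ∑ H ∈ uniformHypergraphs (Fin n) d,
      p ^ H.card * (1 - p) ^ (n.choose d - H.card) * H.card = n.choose d * p := by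
  classical
  set S := Finset.powersetCard d (Finset.univ : Finset (Fin n)) with hS
  have h1 : ∀ h ∈ S, prob n d p {H | {h} ⊆ H} = p := fun h hh => by
    rw [prob_superset, Finset.card_singleton, pow_one]
    exact Finset.mem_powerset.2 (Finset.singleton_subset_iff.2 hh)
  have h2 : ∑ h ∈ S, prob n d p {H | {h} ⊆ H} = n.choose d * p := by
    rw [Finset.sum_congr rfl h1, Finset.sum_const, card_edges, nsmul_eq_mul]
  rw [← h2]
  simp only [prob]
  rw [Finset.sum_comm]
  refine Finset.sum_congr rfl fun H hH => ?_
  have hHS : H ⊆ S := Finset.mem_powerset.1 hH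
  simp only [Set.indicator_apply, Set.mem_ofPred_eq, Finset.singleton_subset_iff]
  rw [← Finset.sum_filter, Finset.sum_const, nsmul_eq_mul, mul_comm,
    Finset.filter_mem_eq_inter, Finset.inter_eq_right.2 hHS]

/-- The ratio of the weights is (p/(1-p))^(a-b) ≤ p/(1-p) ≤ 2p. -/
lemma weight_le_of_card_lt (hp0 : 0 ≤ p) (hp2 : p ≤ 1 / 2) {a b N : ℕ} (hab : b < a)
    (haN : a ≤ N) : p ^ a * (1 - p) ^ (N - a) ≤ 2 * p * (p ^ b * (1 - p) ^ (N - b)) := by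
  obtain ⟨k, rfl⟩ := Nat.exists_eq_add_of_lt hab
  obtain ⟨r, rfl⟩ := Nat.exists_eq_add_of_le haN
  have e1 : b + k + 1 + r - (b + k + 1) = r := by omega
  have e2 : b + k + 1 + r - b = r + k + 1 := by omega
  have hq : 0 ≤ 1 - p := by linarith
  have h1 : p ^ k ≤ (1 - p) ^ k := pow_le_pow_left₀ hp0 (by linarith) k
  have h2 : p ^ k ≤ 2 * ((1 - p) ^ k * (1 - p)) := by
    nlinarith [pow_nonneg hq k]
  rw [e1, e2]
  calc p ^ (b + k + 1) * (1 - p) ^ r = p * p ^ b * (1 - p) ^ r * p ^ k := by ring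
    _ ≤ p * p ^ b * (1 - p) ^ r * (2 * ((1 - p) ^ k * (1 - p))) :=
        mul_le_mul_of_nonneg_left h2 (by positivity)
    _ = _ := by ring

/-- `H` is obtained from the smaller hypergraph `H'` by changing it on a single 2-connected
component, with at most `B` hyperedges, of the clique hypergraph of the projection of `H'`. -/
def IsLocalEnlargement (d B : ℕ) (H' H : Finset (Finset (Fin n))) : Prop :=
  H'.card < H.card ∧ ∃ m ∈ H', (componentOf (cli d (proj H')) m).card ≤ B ∧
    H \ componentOf (cli d (proj H')) m = H' \ componentOf (cli d (proj H')) m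

open Classical in
lemma card_filter_isLocalEnlargement_le (B : ℕ) (H' : Finset (Finset (Fin n)))
    (s : Finset (Finset (Finset (Fin n)))) :
    (s.filter fun H => IsLocalEnlargement d B H' H).card ≤ H'.card * 2 ^ B := by
  let C : Finset (Fin n) → Finset (Finset (Fin n)) := componentOf (cli d (proj H'))
  have hsub : s.filter (fun H => IsLocalEnlargement d B H' H) ⊆
      (H'.filter fun m => (C m).card ≤ B).biUnion fun m =>
        (C m).powerset.image fun Y => H' \ C m ∪ Y := by
    intro H hH
    obtain ⟨-, -, m, hm, hB, hHC⟩ := Finset.mem_filter.1 hH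
    refine Finset.mem_biUnion.2 ⟨m, Finset.mem_filter.2 ⟨hm, hB⟩, Finset.mem_image.2
      ⟨H ∩ C m, Finset.mem_powerset.2 Finset.inter_subset_right, ?_⟩⟩
    rw [← hHC]
    exact Finset.sdiff_union_inter H _
  refine (Finset.card_le_card hsub).trans ((Finset.card_biUnion_le_card_mul _ _ (2 ^ B)
    fun m hm => ?_).trans (Nat.mul_le_mul_right _ (Finset.card_filter_le _ _)))
  refine Finset.card_image_le.trans ?_
  rw [Finset.card_powerset]
  exact Nat.pow_le_pow_right (by norm_num) (Finset.mem_filter.1 hm).2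

/-- Each `H` is charged to a smaller `H'` at a factor 2p. Each `H'` is charged at most |H'| 2^B
times, and the mean of |H'| supplies the second factor p. -/
lemma prob_isLocalEnlargement_le (hp0 : 0 ≤ p) (hp2 : p ≤ 1 / 2) (B : ℕ) :
    prob n d p {H | ∃ H' ∈ uniformHypergraphs (Fin n) d, IsLocalEnlargement d B H' H} ≤
      2 ^ (B + 1) * n.choose d * p ^ 2 := by
  classical
  set U := uniformHypergraphs (Fin n) d with hU
  let w : Finset (Finset (Fin n)) → ℝ := fun H => p ^ H.card * (1 - p) ^ (n.choose d - H.card)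
  have hw : ∀ H, 0 ≤ w H := fun H => weight_nonneg hp0 (by linarith) H
  calc prob n d p {H | ∃ H' ∈ U, IsLocalEnlargement d B H' H}
      ≤ ∑ H ∈ U, ∑ H' ∈ U, if IsLocalEnlargement d B H' H then 2 * p * w H' else 0 := by
        refine Finset.sum_le_sum fun H hH => ?_
        have h0 : ∀ H' ∈ U, 0 ≤ if IsLocalEnlargement d B H' H then 2 * p * w H' else 0 := by
          intro H' _
          split_ifs
          · exact mul_nonneg (by linarith) (hw H')
          · exact le_rfl
        by_cases hA : H ∈ {H | ∃ H' ∈ U, IsLocalEnlargement d B H' H}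
        · obtain ⟨H', hH', hR⟩ := id hA
          rw [Set.indicator_of_mem hA]
          refine le_trans ?_ (Finset.single_le_sum h0 hH')
          rw [if_pos hR]
          exact weight_le_of_card_lt hp0 hp2 hR.1 (card_le_choose hH)
        · rw [Set.indicator_of_notMem hA]
          exact Finset.sum_nonneg h0
    _ = ∑ H' ∈ U, ((U.filter fun H => IsLocalEnlargement d B H' H).card : ℝ) * (2 * p * w H') := by
        rw [Finset.sum_comm]
        refine Finset.sum_congr rfl fun H' _ => ?_
        rw [← Finset.sum_filter, Finset.sum_const, nsmul_eq_mul]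
    _ ≤ ∑ H' ∈ U, ((H'.card : ℝ) * 2 ^ B) * (2 * p * w H') := by
        refine Finset.sum_le_sum fun H' _ => mul_le_mul_of_nonneg_right ?_
          (mul_nonneg (by linarith) (hw H'))
        exact_mod_cast card_filter_isLocalEnlargement_le B H' U
    _ = 2 ^ (B + 1) * p * ∑ H' ∈ U, w H' * H'.card := by
        rw [Finset.mul_sum]
        exact Finset.sum_congr rfl fun H' _ => by ring
    _ = 2 ^ (B + 1) * n.choose d * p ^ 2 := by
        rw [sum_weight_mul_card]
        ring

/-- Group by the vertex set W covered by `F`: boundedly many `F` share one W, and at most n^v sets W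
have size v, cancelling the weight n^(-v). -/
lemma sum_inv_pow_card_sup_le (R : ℕ) (S : Finset (Finset (Finset (Fin n))))
    (hS : ∀ F ∈ S, (F.sup id).card ≤ R) :
    ∑ F ∈ S, ((n : ℝ)⁻¹) ^ (F.sup id).card ≤ (R + 1) * 2 ^ 2 ^ R := by
  classical
  set q : ℝ := (n : ℝ)⁻¹ with hq
  have hq0 : 0 ≤ q := by positivity
  set P := (Finset.univ : Finset (Finset (Fin n))).filter fun W => W.card ≤ R with hP
  have hfib : ∀ W ∈ P, (S.filter fun F => F.sup id = W).card ≤ 2 ^ 2 ^ R := by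
    intro W hW
    have hsub : (S.filter fun F => F.sup id = W) ⊆ W.powerset.powerset := by
      intro F hF
      obtain ⟨-, rfl⟩ := Finset.mem_filter.1 hF
      exact Finset.mem_powerset.2 fun x hx => Finset.mem_powerset.2 (Finset.le_sup (f := id) hx)
    refine (Finset.card_le_card hsub).trans ?_
    rw [Finset.card_powerset, Finset.card_powerset]
    exact Nat.pow_le_pow_right (by norm_num)
      (Nat.pow_le_pow_right (by norm_num) (Finset.mem_filter.1 hW).2)
  have hlevel : ∀ v ∈ Finset.range (R + 1), ∑ W ∈ P.filter (fun W => W.card = v), q ^ W.card ≤ 1 := by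
    intro v _
    have h1 : ∀ W ∈ P.filter (fun W => W.card = v), q ^ W.card = q ^ v := fun W hW => by
      rw [(Finset.mem_filter.1 hW).2]
    rw [Finset.sum_congr rfl h1, Finset.sum_const, nsmul_eq_mul]
    have h2 : (P.filter fun W => W.card = v).card ≤ n ^ v := by
      refine le_trans (Finset.card_le_card (t := Finset.powersetCard v Finset.univ) ?_) ?_
      · intro W hW
        exact Finset.mem_powersetCard.2 ⟨Finset.subset_univ _, (Finset.mem_filter.1 hW).2⟩
      · rw [card_edges]
        exact Nat.choose_le_pow n v
    have h3 : (((P.filter fun W => W.card = v).card : ℕ) : ℝ) ≤ (n : ℝ) ^ v := by exact_mod_cast h2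
    refine (mul_le_mul_of_nonneg_right h3 (pow_nonneg hq0 v)).trans ?_
    rw [← mul_pow]
    exact pow_le_one₀ (by positivity) (mul_inv_le_one)
  calc ∑ F ∈ S, q ^ (F.sup id).card
      = ∑ W ∈ P, ∑ F ∈ S.filter (fun F => F.sup id = W), q ^ (F.sup id).card :=
        (Finset.sum_fiberwise_of_maps_to (fun F hF =>
          Finset.mem_filter.2 ⟨Finset.mem_univ _, hS F hF⟩) _).symm
    _ ≤ ∑ W ∈ P, 2 ^ 2 ^ R * q ^ W.card := by
        refine Finset.sum_le_sum fun W hW => ?_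
        have h1 : ∀ F ∈ S.filter (fun F => F.sup id = W), q ^ (F.sup id).card = q ^ W.card :=
          fun F hF => by rw [(Finset.mem_filter.1 hF).2]
        rw [Finset.sum_congr rfl h1, Finset.sum_const, nsmul_eq_mul]
        refine mul_le_mul_of_nonneg_right ?_ (pow_nonneg hq0 _)
        exact_mod_cast hfib W hW
    _ = 2 ^ 2 ^ R * ∑ v ∈ Finset.range (R + 1), ∑ W ∈ P.filter (fun W => W.card = v),
          q ^ W.card := by
        rw [← Finset.mul_sum, Finset.sum_fiberwise_of_maps_to]
        intro W hW
        have := (Finset.mem_filter.1 hW).2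
        exact Finset.mem_range.2 (by omega)
    _ ≤ 2 ^ 2 ^ R * ∑ v ∈ Finset.range (R + 1), (1 : ℝ) :=
        mul_le_mul_of_nonneg_left (Finset.sum_le_sum hlevel) (by positivity)
    _ = (R + 1) * 2 ^ 2 ^ R := by
        rw [Finset.sum_const, Finset.card_range, nsmul_eq_mul]
        push_cast
        ring

/-- Small dense sets of hyperedges are unlikely. -/
lemma prob_dense_le {δ ε : ℝ} (hn : 1 ≤ n) (hp1 : edgeProb d δ n ≤ 1) (M : ℕ) :
    prob n d (edgeProb d δ n) {H | ∃ F ⊆ H, F.card ≤ M ∧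
      ((F.sup id).card : ℝ) - F.card * ((d : ℝ) - 1 - δ) ≤ -ε} ≤
      ((M * d : ℕ) + 1) * 2 ^ 2 ^ (M * d) * (n : ℝ) ^ (-ε) := by
  classical
  set p := edgeProb d δ n with hp
  have hn0 : (0 : ℝ) < n := by exact_mod_cast hn
  have hn1 : (1 : ℝ) ≤ n := by exact_mod_cast hn
  have hp0 : 0 ≤ p := Real.rpow_nonneg hn0.le _
  set S := (uniformHypergraphs (Fin n) d).filter fun F => F.card ≤ M ∧
      ((F.sup id).card : ℝ) - F.card * ((d : ℝ) - 1 - δ) ≤ -ε with hS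
  have h1 := prob_le_sum hp0 hp1 (d := d) (A := {H | ∃ F ⊆ H, F.card ≤ M ∧
      ((F.sup id).card : ℝ) - F.card * ((d : ℝ) - 1 - δ) ≤ -ε}) S (fun F => {H | F ⊆ H}) (by
    rintro H hH ⟨F, hFH, hF⟩
    exact ⟨F, Finset.mem_filter.2 ⟨mem_uniformHypergraphs.2 fun h hh =>
      mem_uniformHypergraphs.1 hH h (hFH hh), hF⟩, hFH⟩)
  refine h1.trans ?_
  have hterm : ∀ F ∈ S, prob n d p {H | F ⊆ H} ≤
      (n : ℝ) ^ (-ε) * ((n : ℝ)⁻¹) ^ (F.sup id).card := by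
    intro F hF
    obtain ⟨hFU, -, hw⟩ := Finset.mem_filter.1 hF
    rw [prob_superset hFU, hp, edgeProb, ← Real.rpow_natCast, ← Real.rpow_natCast,
      ← Real.rpow_mul hn0.le, Real.inv_rpow hn0.le, ← Real.rpow_neg hn0.le,
      ← Real.rpow_add hn0]
    exact Real.rpow_le_rpow_of_exponent_le hn1 (by linarith)
  refine (Finset.sum_le_sum hterm).trans ?_
  rw [← Finset.mul_sum, mul_comm]
  refine mul_le_mul_of_nonneg_right (sum_inv_pow_card_sup_le (M * d) S fun F hF => ?_)
    (Real.rpow_nonneg hn0.le _)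
  obtain ⟨hFU, hM, -⟩ := Finset.mem_filter.1 hF
  rw [Finset.sup_eq_biUnion]
  exact (Finset.card_biUnion_le_card_mul _ _ d fun x hx =>
    (mem_uniformHypergraphs.1 hFU x hx).le).trans (Nat.mul_le_mul_right _ hM)

end Probability

/-! ### MAP rules, minimum preimages and the ways to fail -/

section Rules

variable {n d : ℕ} {p : ℝ}

lemma posterior_eq_of_isPreimage {G : SimpleGraph (Fin n)} {H : Finset (Finset (Fin n))}
    (hH : IsPreimage d G H) : posterior n d p G H =
      p ^ H.card * (1 - p) ^ (n.choose d - H.card) / prob n d p {H' | proj H' = G} := by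
  rw [posterior]
  congr 1
  rw [prob, Finset.sum_eq_single_of_mem H hH.1]
  · rw [Set.indicator_of_mem (show H ∈ {H' | H' = H ∧ proj H' = G} from ⟨rfl, hH.2⟩)]
  · intro H' _ hne
    exact Set.indicator_of_notMem (fun h => hne h.1) _

lemma posterior_eq_zero {G : SimpleGraph (Fin n)} {H : Finset (Finset (Fin n))}
    (hH : ¬ IsPreimage d G H) : posterior n d p G H = 0 := by
  rw [posterior, prob, Finset.sum_eq_zero, zero_div]
  rintro H' hH'
  refine Set.indicator_of_notMem (fun h => hH ?_) _
  obtain ⟨rfl, h⟩ := h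
  exact ⟨hH', h⟩

/-- All preimages share one normalising constant, so the posterior compares weights, which strictly
decrease in size for p < 1/2; other hypergraphs have posterior zero. -/
lemma IsMAPRule.isMinPreimageRule (hp0 : 0 < p) (hp2 : p < 1 / 2)
    {A : SimpleGraph (Fin n) → Finset (Finset (Fin n))} (hA : IsMAPRule n d p A) :
    IsMinPreimageRule n d A := by
  rintro G ⟨H₀, hH₀⟩
  have hw : ∀ H : Finset (Finset (Fin n)),
      0 < p ^ H.card * (1 - p) ^ (n.choose d - H.card) := fun H =>
    mul_pos (pow_pos hp0 _) (pow_pos (by linarith) _)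
  have hZ : 0 < prob n d p {H' | proj H' = G} := by
    refine Finset.sum_pos' (fun H _ => Set.indicator_nonneg (fun H _ => (hw H).le) H)
      ⟨H₀, hH₀.1, ?_⟩
    rw [Set.indicator_of_mem (show H₀ ∈ {H' | proj H' = G} from hH₀.2)]
    exact hw H₀
  have hpre : IsPreimage d G (A G) := by
    by_contra hcon
    have h := hA G H₀
    rw [posterior_eq_of_isPreimage hH₀, posterior_eq_zero hcon] at h
    exact absurd h (not_le.2 (div_pos (hw H₀) hZ))
  refine ⟨hpre, fun H hH => ?_⟩
  by_contra! hlt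
  have h := hA G H
  rw [posterior_eq_of_isPreimage hH, posterior_eq_of_isPreimage hpre,
    div_le_div_iff_of_pos_right hZ] at h
  have h2 := weight_le_of_card_lt hp0.le hp2.le hlt (card_le_choose hpre.1)
  nlinarith [hw H]

lemma IsPreimage.eq_of_two {G : SimpleGraph (Fin n)} {H : Finset (Finset (Fin n))}
    (hH : IsPreimage 2 G H) : H = cli 2 G := by
  refine hH.subset_cli.antisymm fun x hx => ?_
  rw [← hH.2] at hx
  obtain ⟨h, hh, hxh⟩ := exists_mem_two_le_card_inter le_rfl hx
  have hx2 : x.card = 2 := (mem_cli.1 hx).2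
  have hh2 : h.card = 2 := mem_uniformHypergraphs.1 hH.1 h hh
  have h1 := Finset.eq_of_subset_of_card_le (Finset.inter_subset_left (s₁ := x) (s₂ := h))
    (by omega)
  have h2 := Finset.eq_of_subset_of_card_le (Finset.inter_subset_right (s₁ := x) (s₂ := h))
    (by omega)
  rwa [← h1, h2]

/-- A minimum preimage rule can fail only if there is a small dense set of hyperedges, or a small
component on which the hypergraph is not minimum, or a small ambiguous component. -/
lemma failure_cases (hd : 2 ≤ d) {δ : ℝ} (hδ : δ < ((d : ℝ) - 1) / ((d : ℝ) + 1)) {t K : ℕ}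
    (ht : 2 + δ ≤ t * (((d : ℝ) - 1) / (d + 1) - δ)) (hK : (1 + t * 2 ^ d) * d ≤ K)
    {A : SimpleGraph (Fin n) → Finset (Finset (Fin n))} (hA : IsMinPreimageRule n d A)
    {H : Finset (Finset (Fin n))} (hH : H ∈ uniformHypergraphs (Fin n) d) (hne : A (proj H) ≠ H) :
    (∃ F ⊆ H, F.card ≤ 1 + t * 2 ^ d ∧
      ((F.sup id).card : ℝ) - F.card * ((d : ℝ) - 1 - δ) ≤ -1) ∨
    (∃ H' ∈ uniformHypergraphs (Fin n) d, IsLocalEnlargement d (2 ^ K) H' H) ∨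
    (∃ k ≤ K, ∃ Ga : SimpleGraph (Fin k), IsAmbiguous d Ga ∧ AppearsAsComponent d Ga H) := by
  by_cases hdense : ∃ F ⊆ H, F.card ≤ 1 + t * 2 ^ d ∧
      ((F.sup id).card : ℝ) - F.card * ((d : ℝ) - 1 - δ) ≤ -1
  · exact Or.inl hdense
  refine Or.inr ?_
  push Not at hdense
  have hpre : IsPreimage d (proj H) H := ⟨hH, rfl⟩
  set M := A (proj H) with hM
  have hMmin : IsMinPreimage d (proj H) M := hA _ ⟨H, hpre⟩
  set T := cli d (proj H) with hT
  have hcov : ∀ x ∈ T, ∃ m ∈ M, 2 ≤ (x ∩ m).card := fun x hx => by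
    rw [hT, ← hMmin.1.2] at hx
    exact exists_mem_two_le_card_inter hd hx
  obtain ⟨m, hmH, hmne⟩ := exists_inter_componentOf_ne hpre.subset_cli hMmin.1.subset_cli
    (fun x hx => exists_mem_two_le_card_inter hd hx) hne.symm
  have hmT : m ∈ T := hpre.subset_cli hmH
  -- The component must also be named by a hyperedge of the swapped hypergraph, since the charging
  -- count runs over its hyperedges; `m` need not survive the swap.
  obtain ⟨m', hm'M, hmm'⟩ := hcov m hmT
  have hm'T : m' ∈ T := hMmin.1.subset_cli hm'M
  set C := componentOf T m with hC
  have hCm' : componentOf T m' = C := (componentOf_eq_of_two_le_card_inter hmT hm'T hmm').symm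
  have hclosed : IsTwoClosed T C := isTwoClosed_componentOf
  have hCK : (C.sup id).card ≤ K := by
    refine (card_sup_componentOf_le hδ hH (t := t) (fun F hF hcard => ?_) hmH).trans hK
    have := hdense F hF hcard
    linarith
  have hmin := hMmin.inter hclosed
  have hle := hmin.2 _ (hpre.inter hclosed)
  rcases hle.eq_or_lt with heq | hlt
  -- Equal sizes make `H ∩ C` minimum too, so `proj C` has two distinct minimum preimages.
  · right
    obtain ⟨Ga, hGa, happ⟩ := exists_appearsAsComponent hd hmT ⟨_, _, hmne,
      ⟨hpre.inter hclosed, fun X hX => heq ▸ hmin.2 X hX⟩, hmin⟩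
    exact ⟨_, hCK, Ga, hGa, happ⟩
  · left
    have hH' : IsPreimage d (proj H) (H \ C ∪ M ∩ C) := hpre.sdiff_union hclosed hmin.1
    refine ⟨_, hH'.1, ?_, m', ?_, ?_⟩
    · have h1 := Finset.card_union_le (H \ C) (M ∩ C)
      have h2 := Finset.card_sdiff_add_card_inter H C
      omega
    · refine Finset.mem_union_right _ (Finset.mem_inter.2 ⟨hm'M, ?_⟩)
      rw [← hCm']
      exact mem_componentOf_self hm'T
    · rw [hH'.2, ← hT, hCm']
      constructor
      · have hsub : C ⊆ (C.sup id).powerset := fun x hx =>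
          Finset.mem_powerset.2 (Finset.le_sup (f := id) hx)
        refine (Finset.card_le_card hsub).trans ?_
        rw [Finset.card_powerset]
        exact Nat.pow_le_pow_right (by norm_num) hCK
      · ext x
        simp only [Finset.mem_sdiff, Finset.mem_union, Finset.mem_inter]
        tauto

end Rules

/-! ### Limits as n grows -/

section Asymptotics

variable {d : ℕ} {δ : ℝ}

lemma exponent_neg (hd : 2 ≤ d) (hδ : δ < ((d : ℝ) - 1) / ((d : ℝ) + 1)) :
    -(d : ℝ) + 1 + δ < 0 := by
  have hd' : (2 : ℝ) ≤ d := by exact_mod_cast hd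
  have : ((d : ℝ) - 1) / ((d : ℝ) + 1) ≤ d - 1 :=
    div_le_self (by linarith) (by linarith)
  linarith

lemma tendsto_natCast_rpow_neg {a : ℝ} (ha : a < 0) :
    Tendsto (fun n : ℕ => (n : ℝ) ^ a) atTop (𝓝 0) := by
  have := (tendsto_rpow_neg_atTop (neg_pos.2 ha)).comp tendsto_natCast_atTop_atTop
  simpa [Function.comp_def] using this

lemma eventually_edgeProb (hd : 2 ≤ d) (hδ : δ < ((d : ℝ) - 1) / ((d : ℝ) + 1)) :
    ∀ᶠ n : ℕ in atTop, 1 ≤ n ∧ 0 < edgeProb d δ n ∧ edgeProb d δ n < 1 / 2 := by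
  filter_upwards [eventually_ge_atTop 1,
    (tendsto_natCast_rpow_neg (exponent_neg hd hδ)).eventually_lt_const
      (show (0 : ℝ) < 1 / 2 by norm_num)] with n hn hlt
  exact ⟨hn, Real.rpow_pos_of_pos (by exact_mod_cast hn) _, hlt⟩

lemma choose_mul_edgeProb_sq_le {n : ℕ} (hn : 1 ≤ n) :
    (n.choose d : ℝ) * edgeProb d δ n ^ 2 ≤ (n : ℝ) ^ (2 + 2 * δ - d) := by
  have hn0 : (0 : ℝ) < n := by exact_mod_cast hn
  have h1 : (n.choose d : ℝ) ≤ (n : ℝ) ^ (d : ℝ) := by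
    rw [Real.rpow_natCast]
    exact_mod_cast Nat.choose_le_pow n d
  refine (mul_le_mul_of_nonneg_right h1 (sq_nonneg _)).trans ?_
  rw [edgeProb, ← Real.rpow_mul_natCast hn0.le, ← Real.rpow_add hn0]
  refine le_of_eq ?_
  congr 1
  push_cast
  ring

lemma tendsto_prob_isMinPreimageRule (hd : 2 ≤ d) (hδ : δ < ((d : ℝ) - 1) / ((d : ℝ) + 1))
    (hamb : ∀ (k : ℕ) (Ga : SimpleGraph (Fin k)), IsAmbiguous d Ga →
      Tendsto (fun n : ℕ => prob n d (edgeProb d δ n) {H | AppearsAsComponent d Ga H})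
        atTop (𝓝 0))
    {A : (n : ℕ) → SimpleGraph (Fin n) → Finset (Finset (Fin n))}
    (hA : ∀ᶠ n in atTop, IsMinPreimageRule n d (A n)) :
    Tendsto (fun n : ℕ => prob n d (edgeProb d δ n) {H | A n (proj H) = H}) atTop (𝓝 1) := by
  classical
  rcases hd.eq_or_lt with rfl | hd3
  · refine tendsto_const_nhds.congr' ?_
    filter_upwards [hA] with n hAn
    refine (prob_eq_one_of_forall fun H hH => ?_).symm
    have hpre : IsPreimage 2 (proj H) H := ⟨hH, rfl⟩
    exact (hAn _ ⟨H, hpre⟩).1.eq_of_two.trans hpre.eq_of_two.symm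
  have hεpos : 0 < ((d : ℝ) - 1) / (d + 1) - δ := sub_pos.2 hδ
  -- A single hyperedge has exponent 1 + δ, so this many steps bring it to at most -1.
  obtain ⟨t, ht⟩ := exists_nat_ge ((2 + δ) / (((d : ℝ) - 1) / (d + 1) - δ))
  rw [div_le_iff₀ hεpos] at ht
  set M := 1 + t * 2 ^ d with hM
  set K := M * d with hK
  set P := fun n : ℕ => edgeProb d δ n with hP
  let s : Finset (Σ k : ℕ, SimpleGraph (Fin k)) :=
    (Finset.range (K + 1)).sigma fun k =>
      (Set.toFinite {Ga : SimpleGraph (Fin k) | IsAmbiguous d Ga}).toFinset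
  let f : ℕ → ℝ := fun n => ((M * d : ℕ) + 1) * 2 ^ 2 ^ (M * d) * (n : ℝ) ^ (-1 : ℝ) +
    2 ^ (2 ^ K + 1) * (n : ℝ) ^ (2 + 2 * δ - d) +
    ∑ i ∈ s, prob n d (P n) {H | AppearsAsComponent d i.2 H}
  have hf : Tendsto f atTop (𝓝 0) := by
    have hd' : (3 : ℝ) ≤ d := by exact_mod_cast hd3
    -- Here 2(d-1)/(d+1) ≤ d - 2 exactly because d ≥ 3, with equality at d = 3, where strictness
    -- comes from `hδ`.
    have hexp : 2 + 2 * δ - d < 0 := by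
      rw [lt_div_iff₀ (by linarith)] at hδ
      nlinarith
    have h1 := (tendsto_natCast_rpow_neg (show (-1 : ℝ) < 0 by norm_num)).const_mul
      (((M * d : ℕ) + 1 : ℝ) * 2 ^ 2 ^ (M * d))
    have h2 := (tendsto_natCast_rpow_neg hexp).const_mul ((2 : ℝ) ^ (2 ^ K + 1))
    have h3 : Tendsto (fun n => ∑ i ∈ s, prob n d (P n) {H | AppearsAsComponent d i.2 H})
        atTop (𝓝 (∑ i ∈ s, 0)) := by
      refine tendsto_finsetSum _ fun i hi => hamb i.1 i.2 ?_
      simpa [s] using (Finset.mem_sigma.1 hi).2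
    have h := (h1.add h2).add h3
    simp only [mul_zero, Finset.sum_const_zero, add_zero] at h
    exact h
  have hbound : ∀ᶠ n in atTop, prob n d (P n) {H | A n (proj H) = H}ᶜ ≤ f n := by
    filter_upwards [hA, eventually_edgeProb hd hδ] with n hAn ⟨hn, hp0, hp2⟩
    have hp1 : P n ≤ 1 := hp2.le.trans (by norm_num)
    refine (prob_le_add_add hp0.le hp1
      (B₁ := {H | ∃ F ⊆ H, F.card ≤ M ∧
        ((F.sup id).card : ℝ) - F.card * ((d : ℝ) - 1 - δ) ≤ -1})
      (B₂ := {H | ∃ H' ∈ uniformHypergraphs (Fin n) d, IsLocalEnlargement d (2 ^ K) H' H})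
      (B₃ := {H | ∃ i ∈ s, AppearsAsComponent d i.2 H}) fun H hH hne => ?_).trans ?_
    · rcases failure_cases hd hδ ht le_rfl hAn hH hne with h | h | ⟨k, hk, Ga, hGa, h⟩
      · exact Or.inl h
      · exact Or.inr (Or.inl h)
      · refine Or.inr (Or.inr ⟨⟨k, Ga⟩, Finset.mem_sigma.2 ⟨Finset.mem_range.2 ?_, ?_⟩, h⟩)
        · exact Nat.lt_succ_of_le hk
        · simpa using hGa
    · refine add_le_add (add_le_add (prob_dense_le hn hp1 M) ?_) ?_
      · refine (prob_isLocalEnlargement_le hp0.le hp2.le (2 ^ K)).trans ?_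
        rw [mul_assoc]
        exact mul_le_mul_of_nonneg_left (choose_mul_edgeProb_sq_le hn) (by positivity)
      · exact prob_le_sum hp0.le hp1 s _ fun H _ h => h
  have hzero : Tendsto (fun n => prob n d (P n) {H | A n (proj H) = H}ᶜ) atTop (𝓝 0) := by
    refine tendsto_of_tendsto_of_tendsto_of_le_of_le' tendsto_const_nhds hf ?_ hbound
    filter_upwards [eventually_edgeProb hd hδ] with n ⟨_, hp0, hp2⟩
    exact prob_nonneg hp0.le (hp2.le.trans (by norm_num)) _
  have := hzero.const_sub 1
  rw [sub_zero] at this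
  exact this.congr fun n => (prob_compl _).symm

end Asymptotics

end HypergraphProjection

open HypergraphProjection in
theorem mainTheorem7 (d : ℕ) (hd : 2 ≤ d) (δ : ℝ) (hδ : δ < ((d : ℝ) - 1) / ((d : ℝ) + 1))
    (hamb : ∀ (k : ℕ) (Ga : SimpleGraph (Fin k)), IsAmbiguous d Ga →
      Filter.Tendsto (fun n : ℕ => prob n d (edgeProb d δ n) {H | AppearsAsComponent d Ga H})
        Filter.atTop (nhds 0)) :
    (∀ A : (n : ℕ) → SimpleGraph (Fin n) → Finset (Finset (Fin n)),
      (∀ n, IsMAPRule n d (edgeProb d δ n) (A n)) →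
      Filter.Tendsto (fun n : ℕ => prob n d (edgeProb d δ n) {H | A n (proj H) = H})
        Filter.atTop (nhds 1)) ∧
    (∀ A : (n : ℕ) → SimpleGraph (Fin n) → Finset (Finset (Fin n)),
      (∀ n, IsMinPreimageRule n d (A n)) →
      Filter.Tendsto (fun n : ℕ => prob n d (edgeProb d δ n) {H | A n (proj H) = H})
        Filter.atTop (nhds 1)) := by
  refine ⟨fun A hA => tendsto_prob_isMinPreimageRule hd hδ hamb ?_,
    fun A hA => tendsto_prob_isMinPreimageRule hd hδ hamb (Filter.Eventually.of_forall hA)⟩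
  filter_upwards [eventually_edgeProb hd hδ] with n ⟨_, hp0, hp2⟩
  exact (hA n).isMinPreimageRule hp0 hp2
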